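/- Let $1\le p\le\infty$. Let $F_p$ be the space of complex valued absolutely continuous functions on $[0,1]$ whose first derivative lies in $L_p[0,1]$, and for $d\in\mathbb N$ let $F_{d,p}=\bigotimes_{j=1}^d F_p$ be the algebraic tensor product, regarded as a space of functions on $[0,1]^d$ (the linear span of the products $\prod_{j=1}^d\varphi_j(x_j)$ with $\varphi_j\in F_p$). For $u\subset[d]=\{1,\dots,d\}$ let $f^{(u)}=\prod_{j\in u}\frac{\partial}{\partial x_j}f$, and let $f^{(u)}(x_u;t)$ denote the value of $f^{(u)}$ at the point with coordinates $x_j$ for $j\in u$ and $t_j$ for $j\notin u$. For positive weights $(\gamma_u)_{u\subset[d]}$ define on $F_{d,p}$ the anchored norm and the ANOVA norm $$\|f\|_{\pitchfork,d,p}=\Bigl(\sum_{u\subset[d]}\gamma_u^{-p}\,\bigl\|f^{(u)}(\cdot_u;0)\bigr\|_{L_p([0,1]^u)}^p\Bigr)^{1/p},\qquad \|f\|_{A,d,p}=\Bigl(\sum_{u\subset[d]}\gamma_u^{-p}\,\Bigl\|\int_{[0,1]^{[d]\setminus u}}f^{(u)}(\cdot_u;t)\,dt\Bigr\|_{L_p([0,1]^u)}^p\Bigr)^{1/p}$$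 (with the maximum over $u$ of $\gamma_u^{-1}\|\cdot\|_{L_\infty([0,1]^u)}$ if $p=\infty$), and let $F_{\pitchfork,d,p}$ and $F_{A,d,p}$ be the completions of $F_{d,p}$ in these norms. The spaces are called uniformly equivalent (in $d$) if there is a constant $c>0$, not depending on $d$, such that for every $d$ the identity of $F_{d,p}$ extends to bounded linear maps $J^{\pitchfork,A}_{d,p}:F_{\pitchfork,d,p}\to F_{A,d,p}$ and $J^{A,\pitchfork}_{d,p}:F_{A,d,p}\to F_{\pitchfork,d,p}$ with $\max\bigl(\|J^{\pitchfork,A}_{d,p}\|,\|J^{A,\pitchfork}_{d,p}\|\bigr)\le c$. Let $(\gamma_j)_{j\in\mathbb N}$ be a sequence of positive numbers and take the product weights $\gamma_u=\prod_{j\in u}\gamma_j$. Then the spaces $F_{\pitchfork,d,p}$ and $F_{A,d,p}$ are uniformly equivalent if and only if $(\gamma_j)_{j\in\mathbb N}$ is summable, that is, $\sum_{j}\gamma_j<\infty$. -/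

import Mathlib

noncomputable section

namespace AnchoredAnova

open MeasureTheory unitInterval
open scoped ENNReal

/-! ### The univariate space -/

/-- The derivative of a function on `[0,1]` (one-sided at the end points). -/
def deriv01 (f : I → ℂ) : I → ℂ := fun x =>
  derivWithin (Set.IccExtend zero_le_one f) (Set.Icc (0 : ℝ) 1) (x : ℝ)

/-- `f` belongs to `F_p`: it is a complex valued absolutely continuous function on `[0,1]` whose
first derivative lies in `L_p[0,1]`. -/
def MemF (p : ℝ≥0∞) (f : I → ℂ) : Prop :=
  AbsolutelyContinuousOnInterval (Set.IccExtend zero_le_one f) 0 1 ∧ MemLp (deriv01 f) p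

/-! ### The algebraic tensor product -/

/-- The algebraic tensor product `F_{d,p}` of `d` copies of `F_p`, as a space of functions on
`[0,1]^d`: the linear span of the functions `x ↦ ∏ j, φ j (x j)` with `φ j ∈ F_p`. -/
def tensorSpace (d : ℕ) (p : ℝ≥0∞) : Submodule ℂ ((Fin d → I) → ℂ) :=
  Submodule.span ℂ {f | ∃ φ : Fin d → I → ℂ, (∀ j, MemF p (φ j)) ∧ f = fun x => ∏ j, φ j (x j)}

/-- The partial derivative of a function on `[0,1]^d` in the `j`-th variable. -/
def partialDeriv {d : ℕ} (j : Fin d) (f : (Fin d → I) → ℂ) : (Fin d → I) → ℂ := fun x =>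
  deriv01 (fun s => f (Function.update x j s)) (x j)

/-- The mixed derivative `f^{(u)}`, one derivative in each variable `x_j`, `j ∈ u`. -/
def mixedDeriv {d : ℕ} (u : Finset (Fin d)) (f : (Fin d → I) → ℂ) : (Fin d → I) → ℂ :=
  u.sort.foldr partialDeriv f

/-- The point `(x_u; t_{u^c})` of `[0,1]^d`. -/
def glue {d : ℕ} (u : Finset (Fin d)) (x : {j // j ∈ u} → I) (t : {j // j ∉ u} → I) : Fin d → I :=
  fun j => if h : j ∈ u then x ⟨j, h⟩ else t ⟨j, h⟩

/-- The term `f^{(u)}(·_u; 0)` of the anchored norm. -/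
def anchoredTerm {d : ℕ} (u : Finset (Fin d)) (f : (Fin d → I) → ℂ) (x : {j // j ∈ u} → I) : ℂ :=
  mixedDeriv u f (glue u x 0)

/-- The term `∫ f^{(u)}(·_u; t) dt`, `t ∈ [0,1]^{[d] ∖ u}`, of the ANOVA norm. -/
def anovaTerm {d : ℕ} (u : Finset (Fin d)) (f : (Fin d → I) → ℂ) (x : {j // j ∈ u} → I) : ℂ :=
  ∫ t : {j // j ∉ u} → I, mixedDeriv u f (glue u x t)

/-! ### Helper facts: both terms lie in `L_p` and are linear in `f ∈ F_{d,p}` -/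

/-- `f` is written as the finite sum `∑ k, c k * ∏ j, φ k j (x j)` with `φ k j ∈ F_p`. -/
def IsRep {d : ℕ} (p : ℝ≥0∞) (f : (Fin d → I) → ℂ) {κ : Type} [Fintype κ] (c : κ → ℂ)
    (φ : κ → Fin d → I → ℂ) : Prop :=
  (∀ k j, MemF p (φ k j)) ∧ f = fun x => ∑ k, c k * ∏ j, φ k j (x j)

theorem IsRep.add {d : ℕ} {p : ℝ≥0∞} {f g : (Fin d → I) → ℂ} {κ κ' : Type} [Fintype κ]
    [Fintype κ'] {c : κ → ℂ} {c' : κ' → ℂ} {φ : κ → Fin d → I → ℂ} {φ' : κ' → Fin d → I → ℂ}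
    (hf : IsRep p f c φ) (hg : IsRep p g c' φ') :
    IsRep p (f + g) (Sum.elim c c') (Sum.elim φ φ') := by
  refine ⟨?_, ?_⟩
  · rintro (k | k) j
    · exact hf.1 k j
    · exact hg.1 k j
  · rw [hf.2, hg.2]
    funext x
    simp [Fintype.sum_sum_type]

theorem IsRep.smul {d : ℕ} {p : ℝ≥0∞} {f : (Fin d → I) → ℂ} {κ : Type} [Fintype κ]
    {c : κ → ℂ} {φ : κ → Fin d → I → ℂ} (hf : IsRep p f c φ) (a : ℂ) :
    IsRep p (a • f) (fun k => a * c k) φ := by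
  refine ⟨hf.1, ?_⟩
  rw [hf.2]
  funext x
  simp [Finset.mul_sum, mul_assoc]

theorem exists_isRep {d : ℕ} {p : ℝ≥0∞} {f : (Fin d → I) → ℂ} (hf : f ∈ tensorSpace d p) :
    ∃ (κ : Type) (_ : Fintype κ) (c : κ → ℂ) (φ : κ → Fin d → I → ℂ), IsRep p f c φ := by
  induction hf using Submodule.span_induction with
  | mem f hf =>
    obtain ⟨φ, h1, h2⟩ := hf
    exact ⟨Unit, inferInstance, fun _ => 1, fun _ => φ, fun _ => h1, by simp [h2]⟩
  | zero =>
    exact ⟨Empty, inferInstance, Empty.elim, fun k => k.elim, fun k => k.elim, by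
      funext x; simp⟩
  | add f g _ _ hf hg =>
    obtain ⟨κ, i, c, φ, h⟩ := hf
    obtain ⟨κ', i', c', φ', h'⟩ := hg
    exact ⟨κ ⊕ κ', inferInstance, _, _, h.add h'⟩
  | smul a f _ hf =>
    obtain ⟨κ, i, c, φ, h⟩ := hf
    exact ⟨κ, i, _, _, h.smul a⟩

/-- Differentiability at a point of `[0,1]`. -/
def Diff01 (f : I → ℂ) (x : I) : Prop :=
  DifferentiableWithinAt ℝ (Set.IccExtend zero_le_one f) (Set.Icc (0 : ℝ) 1) (x : ℝ)

theorem MemF.ae_diff {p : ℝ≥0∞} {f : I → ℂ} (hf : MemF p f) : ∀ᵐ x : I, Diff01 f x := by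
  have h := hf.1.boundedVariationOn
  rw [Set.uIcc_of_le zero_le_one] at h
  have h2 := h.locallyBoundedVariationOn.ae_differentiableWithinAt_of_mem
  exact (unitInterval.measurePreserving_coe.quasiMeasurePreserving.ae
    ((ae_restrict_iff' measurableSet_Icc).2 h2))

theorem MemF.continuous {p : ℝ≥0∞} {f : I → ℂ} (hf : MemF p f) : Continuous f := by
  have h := hf.1.continuousOn
  rw [Set.uIcc_of_le zero_le_one, continuousOn_iff_continuous_domRestrict] at h
  convert! h using 1
  funext x
  simp [Set.IccExtend_val]

theorem deriv01_sum {κ : Type} [Fintype κ] {a : κ → ℂ} {φ : κ → I → ℂ} {x : I}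
    (h : ∀ k, Diff01 (φ k) x) :
    deriv01 (fun s => ∑ k, a k * φ k s) x = ∑ k, a k * deriv01 (φ k) x := by
  have : Set.IccExtend zero_le_one (fun s : I => ∑ k, a k * φ k s)
      = fun s : ℝ => ∑ k, a k * Set.IccExtend zero_le_one (φ k) s := by
    funext s; simp [Set.IccExtend]
  unfold deriv01
  rw [this]
  refine HasDerivWithinAt.derivWithin ?_ (uniqueDiffOn_Icc_zero_one _ x.2)
  exact HasDerivWithinAt.fun_sum fun k _ => (h k).hasDerivWithinAt.const_mul (a k)

theorem foldr_partialDeriv {d : ℕ} {κ : Type} [Fintype κ] (c : κ → ℂ) (φ : κ → Fin d → I → ℂ)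
    (l : List (Fin d)) (hl : l.Nodup) (x : Fin d → I)
    (hx : ∀ k, ∀ j ∈ l, Diff01 (φ k j) (x j)) :
    l.foldr partialDeriv (fun x => ∑ k, c k * ∏ j, φ k j (x j)) x
      = ∑ k, c k * ∏ j, (if j ∈ l then deriv01 (φ k j) (x j) else φ k j (x j)) := by
  induction l generalizing x with
  | nil => simp
  | cons i l ih =>
    obtain ⟨hi, hl⟩ := List.nodup_cons.1 hl
    have key : ∀ s : I, l.foldr partialDeriv (fun x => ∑ k, c k * ∏ j, φ k j (x j))
        (Function.update x i s) = ∑ k, (c k * ∏ j ∈ Finset.univ.erase i,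
          (if j ∈ l then deriv01 (φ k j) (x j) else φ k j (x j))) * φ k i s := by
      intro s
      rw [ih hl]
      · refine Finset.sum_congr rfl fun k _ => ?_
        rw [← Finset.mul_prod_erase _ _ (Finset.mem_univ i), mul_assoc]
        congr 1
        rw [mul_comm]
        congr 1
        · refine Finset.prod_congr rfl fun j hj => ?_
          rw [Function.update_of_ne (Finset.ne_of_mem_erase hj)]
        · simp [hi]
      · intro k j hj
        have : j ≠ i := fun h => hi (h ▸ hj)
        rw [Function.update_of_ne this]
        exact hx k j (List.mem_cons_of_mem _ hj)
    rw [List.foldr_cons]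
    change deriv01 (fun s => l.foldr partialDeriv _ (Function.update x i s)) (x i) = _
    simp only [key]
    rw [deriv01_sum fun k => hx k i List.mem_cons_self]
    refine Finset.sum_congr rfl fun k _ => ?_
    rw [← Finset.mul_prod_erase (a := i) Finset.univ _ (Finset.mem_univ i), mul_assoc]
    congr 1
    rw [mul_comm]
    congr 1
    · simp
    · refine Finset.prod_congr rfl fun j hj => ?_
      simp [Finset.ne_of_mem_erase hj]

theorem mixedDeriv_glue {d : ℕ} {p : ℝ≥0∞} {f : (Fin d → I) → ℂ} {κ : Type} [Fintype κ]
    {c : κ → ℂ} {φ : κ → Fin d → I → ℂ} (hf : IsRep p f c φ) (u : Finset (Fin d)) :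
    ∀ᵐ x : {j // j ∈ u} → I, ∀ t, mixedDeriv u f (glue u x t)
      = ∑ k, c k * ((∏ j : {j // j ∈ u}, deriv01 (φ k j) (x j)) * ∏ j : {j // j ∉ u}, φ k j (t j)) := by
  have h : ∀ᵐ x : {j // j ∈ u} → I, ∀ k, ∀ j : {j // j ∈ u}, Diff01 (φ k j) (x j) := by
    rw [ae_all_iff]; intro k
    rw [ae_all_iff]; intro j
    exact (measurePreserving_eval (fun _ : {j // j ∈ u} => (volume : Measure I)) j).quasiMeasurePreserving.ae
      (hf.1 k j).ae_diff
  filter_upwards [h] with x hx t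
  rw [hf.2, mixedDeriv, foldr_partialDeriv _ _ _ (Finset.sort_nodup _ _)]
  · refine Finset.sum_congr rfl fun k _ => ?_
    congr 1
    refine (Fintype.prod_subtype_mul_prod_subtype (fun j => j ∈ u) _).symm.trans ?_
    refine congrArg₂ (· * ·) ?_ ?_
    · refine Finset.prod_congr (by ext; simp) fun j _ => ?_
      simp [glue, j.2]
    · refine Finset.prod_congr (by ext; simp) fun j _ => ?_
      simp [glue, j.2]
  · intro k j hj
    have hj' : j ∈ u := by simpa using hj
    simpa [glue, hj'] using hx k ⟨j, hj'⟩

theorem anchoredTerm_ae {d : ℕ} {p : ℝ≥0∞} {f : (Fin d → I) → ℂ} {κ : Type} [Fintype κ]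
    {c : κ → ℂ} {φ : κ → Fin d → I → ℂ} (hf : IsRep p f c φ) (u : Finset (Fin d)) :
    anchoredTerm u f =ᵐ[volume] fun x =>
      ∑ k, c k * ((∏ j : {j // j ∈ u}, deriv01 (φ k j) (x j)) * ∏ j : {j // j ∉ u}, φ k j 0) := by
  filter_upwards [mixedDeriv_glue hf u] with x hx
  exact hx 0

theorem anovaTerm_ae {d : ℕ} {p : ℝ≥0∞} {f : (Fin d → I) → ℂ} {κ : Type} [Fintype κ]
    {c : κ → ℂ} {φ : κ → Fin d → I → ℂ} (hf : IsRep p f c φ) (u : Finset (Fin d)) :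
    anovaTerm u f =ᵐ[volume] fun x =>
      ∑ k, c k * ((∏ j : {j // j ∈ u}, deriv01 (φ k j) (x j)) * ∏ j : {j // j ∉ u}, ∫ s, φ k j s) := by
  filter_upwards [mixedDeriv_glue hf u] with x hx
  unfold anovaTerm
  simp only [hx]
  rw [integral_finsetSum]
  · refine Finset.sum_congr rfl fun k _ => ?_
    rw [integral_const_mul, integral_const_mul]
    congr 2
    exact integral_fintype_prod_volume_eq_prod
      (fun (j : {j // j ∉ u}) (s : I) => φ k j s)
  · intro k _
    refine Integrable.const_mul (Integrable.const_mul ?_ _) _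
    have hc : Continuous fun t : {j // j ∉ u} → I => ∏ j : {j // j ∉ u}, φ k j (t j) :=
      continuous_finsetProd _ fun j _ => (hf.1 k j).continuous.comp (continuous_apply j)
    exact hc.integrable_of_hasCompactSupport (HasCompactSupport.of_compactSpace _)

theorem memLp_prod {ι : Type} [Fintype ι] {p : ℝ≥0∞} (hp : p ≠ 0) {g : ι → I → ℂ}
    (hg : ∀ j, MemLp (g j) p) : MemLp (fun x : ι → I => ∏ j, g j (x j)) p := by
  have hm : AEStronglyMeasurable (fun x : ι → I => ∏ j, g j (x j)) := by
    refine Finset.aestronglyMeasurable_fun_prod _ fun j _ => ?_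
    exact (hg j).1.comp_quasiMeasurePreserving
      (measurePreserving_eval (fun _ : ι => (volume : Measure I)) j).quasiMeasurePreserving
  by_cases hp' : p = ∞
  · subst hp'
    have hb : ∀ᵐ x : ι → I, ∀ j, ‖g j (x j)‖ ≤ (eLpNorm (g j) ∞ volume).toReal := by
      rw [ae_all_iff]; intro j
      refine (measurePreserving_eval (fun _ : ι => (volume : Measure I)) j).quasiMeasurePreserving.ae
        (p := fun s => ‖g j s‖ ≤ (eLpNorm (g j) ∞ volume).toReal) ?_
      filter_upwards [ae_le_eLpNormEssSup (f := g j) (μ := volume)] with s hs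
      rw [← toReal_enorm]
      exact ENNReal.toReal_mono (hg j).2.ne (by simpa using hs)
    refine memLp_top_of_bound hm (∏ j, (eLpNorm (g j) ∞ volume).toReal) ?_
    filter_upwards [hb] with x hx
    rw [norm_prod]
    exact Finset.prod_le_prod (fun _ _ => norm_nonneg _) fun j _ => hx j
  · rw [← integrable_norm_rpow_iff hm hp hp']
    have : (fun x : ι → I => ‖∏ j, g j (x j)‖ ^ p.toReal)
        = fun x => ∏ j, ‖g j (x j)‖ ^ p.toReal := by
      funext x
      rw [norm_prod, Real.finsetProd_rpow _ _ fun _ _ => norm_nonneg _]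
    rw [this]
    exact Integrable.fintype_prod (f := fun j s => ‖g j s‖ ^ p.toReal)
      fun j => (integrable_norm_rpow_iff (hg j).1 hp hp').2 (hg j)

theorem memLp_aux {d : ℕ} {p : ℝ≥0∞} [hp : Fact (1 ≤ p)] {κ : Type} [Fintype κ]
    {φ : κ → Fin d → I → ℂ} (hφ : ∀ k j, MemF p (φ k j)) (u : Finset (Fin d)) (c : κ → ℂ)
    (b : κ → ℂ) : MemLp (fun x : {j // j ∈ u} → I =>
      ∑ k, c k * ((∏ j : {j // j ∈ u}, deriv01 (φ k j) (x j)) * b k)) p := by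
  refine memLp_finsetSum _ fun k _ => ?_
  refine MemLp.const_mul (MemLp.mul_const ?_ _) _
  exact memLp_prod (zero_lt_one.trans_le hp.out).ne' fun j => (hφ k j).2

theorem memLp_anchoredTerm {d : ℕ} {p : ℝ≥0∞} [Fact (1 ≤ p)] (u : Finset (Fin d))
    (f : tensorSpace d p) : MemLp (anchoredTerm u f.1) p := by
  obtain ⟨κ, _, c, φ, h⟩ := exists_isRep f.2
  exact (memLp_congr_ae (anchoredTerm_ae h u)).2 (memLp_aux h.1 u c _)

theorem memLp_anovaTerm {d : ℕ} {p : ℝ≥0∞} [Fact (1 ≤ p)] (u : Finset (Fin d))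
    (f : tensorSpace d p) : MemLp (anovaTerm u f.1) p := by
  obtain ⟨κ, _, c, φ, h⟩ := exists_isRep f.2
  exact (memLp_congr_ae (anovaTerm_ae h u)).2 (memLp_aux h.1 u c _)

theorem anchoredTerm_add {d : ℕ} {p : ℝ≥0∞} (u : Finset (Fin d)) (f g : tensorSpace d p) :
    anchoredTerm u (f + g).1 =ᵐ[volume] anchoredTerm u f.1 + anchoredTerm u g.1 := by
  obtain ⟨κ, _, c, φ, h⟩ := exists_isRep f.2
  obtain ⟨κ', _, c', φ', h'⟩ := exists_isRep g.2
  filter_upwards [anchoredTerm_ae h u, anchoredTerm_ae h' u, anchoredTerm_ae (h.add h') u]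
    with x h1 h2 h3
  rw [Pi.add_apply, h1, h2]
  exact h3.trans (by simp [Fintype.sum_sum_type])

theorem anovaTerm_add {d : ℕ} {p : ℝ≥0∞} (u : Finset (Fin d)) (f g : tensorSpace d p) :
    anovaTerm u (f + g).1 =ᵐ[volume] anovaTerm u f.1 + anovaTerm u g.1 := by
  obtain ⟨κ, _, c, φ, h⟩ := exists_isRep f.2
  obtain ⟨κ', _, c', φ', h'⟩ := exists_isRep g.2
  filter_upwards [anovaTerm_ae h u, anovaTerm_ae h' u, anovaTerm_ae (h.add h') u]
    with x h1 h2 h3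
  rw [Pi.add_apply, h1, h2]
  exact h3.trans (by simp [Fintype.sum_sum_type])

theorem anchoredTerm_smul {d : ℕ} {p : ℝ≥0∞} (u : Finset (Fin d)) (a : ℂ)
    (f : tensorSpace d p) :
    anchoredTerm u (a • f).1 =ᵐ[volume] a • anchoredTerm u f.1 := by
  obtain ⟨κ, _, c, φ, h⟩ := exists_isRep f.2
  filter_upwards [anchoredTerm_ae h u, anchoredTerm_ae (h.smul a) u] with x h1 h2
  rw [Pi.smul_apply, h1]
  exact h2.trans (by simp [Finset.mul_sum, mul_assoc])

theorem anovaTerm_smul {d : ℕ} {p : ℝ≥0∞} (u : Finset (Fin d)) (a : ℂ)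
    (f : tensorSpace d p) :
    anovaTerm u (a • f).1 =ᵐ[volume] a • anovaTerm u f.1 := by
  obtain ⟨κ, _, c, φ, h⟩ := exists_isRep f.2
  filter_upwards [anovaTerm_ae h u, anovaTerm_ae (h.smul a) u] with x h1 h2
  rw [Pi.smul_apply, h1]
  exact h2.trans (by simp [Finset.mul_sum, mul_assoc])

/-! ### The anchored and the ANOVA norm -/

/-- The `ℓ_p`-sum of the spaces `L_p([0,1]^u)`, `u ⊂ [d]`. -/
abbrev LpSum (d : ℕ) (p : ℝ≥0∞) : Type :=
  PiLp p fun u : Finset (Fin d) => Lp ℂ p (volume : Measure ({j // j ∈ u} → I))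

/-- `f ↦ (γ_u⁻¹ f^{(u)}(·_u; 0))_u`, an element of the `ℓ_p`-sum. -/
def anchoredMap (d : ℕ) (p : ℝ≥0∞) [Fact (1 ≤ p)] (γ : Finset (Fin d) → ℝ) :
    tensorSpace d p →ₗ[ℂ] LpSum d p where
  toFun f := WithLp.toLp p fun u => ((γ u)⁻¹ : ℝ) • (memLp_anchoredTerm u f).toLp _
  map_add' f g := by
    ext1 u
    simp only [PiLp.add_apply, ← smul_add, ← MemLp.toLp_add]
    congr 1
    exact MemLp.toLp_congr _ _ (anchoredTerm_add u f g)
  map_smul' a f := by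
    ext1 u
    simp only [PiLp.smul_apply, RingHom.id_apply]
    rw [smul_comm a]
    congr 1
    rw [← MemLp.toLp_const_smul]
    exact MemLp.toLp_congr _ _ (anchoredTerm_smul u a f)

/-- `f ↦ (γ_u⁻¹ ∫ f^{(u)}(·_u; t) dt)_u`, an element of the `ℓ_p`-sum. -/
def anovaMap (d : ℕ) (p : ℝ≥0∞) [Fact (1 ≤ p)] (γ : Finset (Fin d) → ℝ) :
    tensorSpace d p →ₗ[ℂ] LpSum d p where
  toFun f := WithLp.toLp p fun u => ((γ u)⁻¹ : ℝ) • (memLp_anovaTerm u f).toLp _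
  map_add' f g := by
    ext1 u
    simp only [PiLp.add_apply, ← smul_add, ← MemLp.toLp_add]
    congr 1
    exact MemLp.toLp_congr _ _ (anovaTerm_add u f g)
  map_smul' a f := by
    ext1 u
    simp only [PiLp.smul_apply, RingHom.id_apply]
    rw [smul_comm a]
    congr 1
    rw [← MemLp.toLp_const_smul]
    exact MemLp.toLp_congr _ _ (anovaTerm_smul u a f)

/-- `F_{d,p}` with the anchored norm
`(∑_u γ_u^{-p} ‖f^{(u)}(·_u; 0)‖_p^p)^{1/p}` (a maximum over `u` if `p = ∞`), for positive
weights `γ_u`. -/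
def PreAnchored (d : ℕ) (p : ℝ≥0∞) (_γ : Finset (Fin d) → ℝ) : Type := tensorSpace d p

/-- `F_{d,p}` with the ANOVA norm
`(∑_u γ_u^{-p} ‖∫ f^{(u)}(·_u; t) dt‖_p^p)^{1/p}` (a maximum over `u` if `p = ∞`), for positive
weights `γ_u`. -/
def PreAnova (d : ℕ) (p : ℝ≥0∞) (_γ : Finset (Fin d) → ℝ) : Type := tensorSpace d p

instance (d : ℕ) (p : ℝ≥0∞) (γ : Finset (Fin d) → ℝ) : AddCommGroup (PreAnchored d p γ) :=
  inferInstanceAs (AddCommGroup (tensorSpace d p))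

instance (d : ℕ) (p : ℝ≥0∞) (γ : Finset (Fin d) → ℝ) : AddCommGroup (PreAnova d p γ) :=
  inferInstanceAs (AddCommGroup (tensorSpace d p))

instance (d : ℕ) (p : ℝ≥0∞) (γ : Finset (Fin d) → ℝ) : Module ℂ (PreAnchored d p γ) :=
  inferInstanceAs (Module ℂ (tensorSpace d p))

instance (d : ℕ) (p : ℝ≥0∞) (γ : Finset (Fin d) → ℝ) : Module ℂ (PreAnova d p γ) :=
  inferInstanceAs (Module ℂ (tensorSpace d p))

instance (d : ℕ) (p : ℝ≥0∞) [Fact (1 ≤ p)] (γ : Finset (Fin d) → ℝ) :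
    SeminormedAddCommGroup (PreAnchored d p γ) :=
  SeminormedAddCommGroup.induced (PreAnchored d p γ) (LpSum d p)
    (show PreAnchored d p γ →ₗ[ℂ] LpSum d p from anchoredMap d p γ)

instance (d : ℕ) (p : ℝ≥0∞) [Fact (1 ≤ p)] (γ : Finset (Fin d) → ℝ) :
    SeminormedAddCommGroup (PreAnova d p γ) :=
  SeminormedAddCommGroup.induced (PreAnova d p γ) (LpSum d p)
    (show PreAnova d p γ →ₗ[ℂ] LpSum d p from anovaMap d p γ)

instance (d : ℕ) (p : ℝ≥0∞) [Fact (1 ≤ p)] (γ : Finset (Fin d) → ℝ) :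
    NormedSpace ℂ (PreAnchored d p γ) :=
  NormedSpace.induced ℂ (PreAnchored d p γ) (LpSum d p)
    (show PreAnchored d p γ →ₗ[ℂ] LpSum d p from anchoredMap d p γ)

instance (d : ℕ) (p : ℝ≥0∞) [Fact (1 ≤ p)] (γ : Finset (Fin d) → ℝ) :
    NormedSpace ℂ (PreAnova d p γ) :=
  NormedSpace.induced ℂ (PreAnova d p γ) (LpSum d p)
    (show PreAnova d p γ →ₗ[ℂ] LpSum d p from anovaMap d p γ)

/-- The anchored space: the completion of `F_{d,p}` in the anchored norm. -/
abbrev AnchoredSpace (d : ℕ) (p : ℝ≥0∞) [Fact (1 ≤ p)] (γ : Finset (Fin d) → ℝ) : Type :=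
  UniformSpace.Completion (PreAnchored d p γ)

/-- The ANOVA space: the completion of `F_{d,p}` in the ANOVA norm. -/
abbrev AnovaSpace (d : ℕ) (p : ℝ≥0∞) [Fact (1 ≤ p)] (γ : Finset (Fin d) → ℝ) : Type :=
  UniformSpace.Completion (PreAnova d p γ)

/-- A function in `F_{d,p}` as an element of the anchored space. -/
def toAnchored {d : ℕ} {p : ℝ≥0∞} [Fact (1 ≤ p)] (γ : Finset (Fin d) → ℝ)
    (f : tensorSpace d p) : AnchoredSpace d p γ :=
  ((show PreAnchored d p γ from f : PreAnchored d p γ) : AnchoredSpace d p γ)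

/-- A function in `F_{d,p}` as an element of the ANOVA space. -/
def toAnova {d : ℕ} {p : ℝ≥0∞} [Fact (1 ≤ p)] (γ : Finset (Fin d) → ℝ)
    (f : tensorSpace d p) : AnovaSpace d p γ :=
  ((show PreAnova d p γ from f : PreAnova d p γ) : AnovaSpace d p γ)

/-- The anchored and the ANOVA spaces for the weights `γ d u`, `u ⊂ [d]`, are uniformly equivalent
in `d`: the identity of `F_{d,p}` extends to bounded maps between the two spaces, in both
directions (such an extension is unique, as `F_{d,p}` is dense), and their operator norms are
bounded by a constant that does not depend on `d`. -/
def UniformlyEquivalent (p : ℝ≥0∞) [Fact (1 ≤ p)] (γ : (d : ℕ) → Finset (Fin d) → ℝ) : Prop :=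
  ∃ c : ℝ, 0 < c ∧ ∀ d : ℕ,
    ∃ (J : AnchoredSpace d p (γ d) →L[ℂ] AnovaSpace d p (γ d))
      (J' : AnovaSpace d p (γ d) →L[ℂ] AnchoredSpace d p (γ d)),
      (∀ f : tensorSpace d p, J (toAnchored (γ d) f) = toAnova (γ d) f) ∧
      (∀ f : tensorSpace d p, J' (toAnova (γ d) f) = toAnchored (γ d) f) ∧
      max ‖J‖ ‖J'‖ ≤ c

end AnchoredAnova

end

/-!
The `u`-th terms of the two norms of `f = ∑ k, c k * ∏ j, φ k j (x j)` have the same shape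
`∑ k, c k * ∏_{j ∈ u} (φ k j)' (x j) * ∏_{j ∉ u} a k j` (`tensorTerm`); only the scalars differ,
`a k j = φ k j 0` for the anchored norm and `a k j = ∫ φ k j` for the ANOVA norm. Integration by
parts gives `∫ φ = φ 0 + ∫ (1 - s) φ' s ds` (`MemF.integral_eq`), so the two choices of scalars
differ by the integral of `φ'` against a kernel that is bounded by `1`.

*Summable weights.* With `θ s = ±(1 - s)`, expanding `∏_{j ∉ u} (a k j + ∫ θ (φ k j)')` writes the
`u`-th term for one choice as a sum over `w ⊂ uᶜ` of averages, in the variables of `w`, of the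
`(u ∪ w)`-th terms for the other choice. Averaging contracts `L_p`, whence `eLpNorm_tensorTerm_le`. After multiplication by
`γ_u⁻¹ = γ_w γ_{u ∪ w}⁻¹` the sequence of terms is dominated by `∑_w γ_w S_w`, applied to the other
sequence, where the `S_w` are contractions of `ℓ_p`. Both embeddings thus have norm at most
`∑_w γ_w = ∏_j (1 + γ_j) ≤ exp (∑_j γ_j)`.

*Necessity.* For `f = ∏_j (1 + γ_j x_j)` all `2^d` weighted anchored terms are equal to `1`, and the
weighted ANOVA terms are `∏_{j ∉ u} (1 + γ_j / 2)`. By the power mean inequality, the ratio of the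
norms is at least the average of the latter over `u`, which is
`∏_j (1 + γ_j / 4) ≥ 1 + ∑_j γ_j / 4`. This argument is uniform in `1 ≤ p ≤ ∞`.
-/

noncomputable section

namespace AnchoredAnova

open MeasureTheory unitInterval
open scoped ENNReal

/-! ### Integration by parts for absolutely continuous functions -/

theorem absolutelyContinuousOnInterval_clm_comp {F : ℝ → ℂ} {a b : ℝ}
    (hF : AbsolutelyContinuousOnInterval F a b) (L : ℂ →L[ℝ] ℝ) :
    AbsolutelyContinuousOnInterval (fun x => L (F x)) a b := by
  refine squeeze_zero (fun t => Finset.sum_nonneg fun i _ => dist_nonneg) (fun t => ?_)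
    (by simpa using Filter.Tendsto.const_mul ‖L‖ hF)
  rw [Finset.mul_sum]
  gcongr
  rw [dist_eq_norm, dist_eq_norm, ← map_sub]
  exact L.le_opNorm _

theorem integral_unitInterval_eq {E : Type*} [NormedAddCommGroup E] [NormedSpace ℝ E]
    (g : ℝ → E) : ∫ s : I, g s = ∫ x in (0 : ℝ)..1, g x := by
  rw [intervalIntegral.integral_of_le zero_le_one, ← integral_Icc_eq_integral_Ioc]
  exact unitInterval.measurePreserving_coe.integral_comp
    unitInterval.measurableEmbedding_coe g

theorem MemF.integrable_deriv01 {p : ℝ≥0∞} (hp : 1 ≤ p) {f : I → ℂ} (hf : MemF p f) :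
    Integrable (deriv01 f) :=
  hf.2.integrable hp

/-- The real-linear form of the integration by parts formula `MemF.integral_eq`. -/
theorem MemF.clm_integral_eq {p : ℝ≥0∞} {f : I → ℂ} (hf : MemF p f) (L : ℂ →L[ℝ] ℝ) :
    ∫ s : I, (1 - (s : ℝ)) * L (deriv01 f s) = (∫ s : I, L (f s)) - L (f 0) := by
  set F : ℝ → ℂ := Set.IccExtend zero_le_one f with hF
  have hFv : ∀ s : I, F s = f s := fun s => Set.IccExtend_val _ _ _
  have hac := absolutelyContinuousOnInterval_clm_comp hf.1 L
  have hg : AbsolutelyContinuousOnInterval (fun x : ℝ => 1 - x) 0 1 :=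
    (by fun_prop : ContDiff ℝ 1 fun x : ℝ => 1 - x).contDiffOn.absolutelyContinuousOnInterval
  have key := hg.integral_mul_deriv_eq_deriv_mul hac
  have h0 : F 0 = f 0 := hFv 0
  have hd : ∀ x : ℝ, deriv (fun x : ℝ => 1 - x) x = -1 := fun x => by simp
  simp only [hd, sub_self, zero_mul, sub_zero, one_mul, neg_mul,
    intervalIntegral.integral_neg] at key
  rw [← hF, h0] at key
  have h1 : ∫ s : I, L (f s) = ∫ x in (0 : ℝ)..1, L (F x) := by
    rw [← integral_unitInterval_eq fun x => L (F x)]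
    simp only [hFv]
  rw [h1, ← neg_add_eq_sub, ← zero_sub, ← sub_neg_eq_add, ← key,
    ← integral_unitInterval_eq fun x => (1 - x) * deriv (fun x => L (F x)) x]
  -- the end points, where `deriv01` is one-sided, form a null set
  refine integral_congr_ae ?_
  filter_upwards [hf.ae_diff, compl_mem_ae_iff.2 (measure_singleton (0 : I)),
    compl_mem_ae_iff.2 (measure_singleton (1 : I))] with s hs hs0 hs1
  have hs0' : (0 : ℝ) < s := unitInterval.coe_pos.2 (unitInterval.pos_iff_ne_zero.2 hs0)
  have hs1' : (s : ℝ) < 1 := unitInterval.coe_lt_one.2 (unitInterval.lt_one_iff_ne_one.2 hs1)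
  have hnhds := Icc_mem_nhds hs0' hs1'
  have hFs : HasDerivAt F (deriv01 f s) s := hs.hasDerivWithinAt.hasDerivAt hnhds
  have hLF : HasDerivAt (fun x => L (F x)) (L (deriv01 f s)) s :=
    L.hasFDerivAt.comp_hasDerivAt (s : ℝ) hFs
  rw [hLF.deriv]

/-- Integration by parts with the primitive `s - 1` of `1`, which vanishes at `1`. -/
theorem MemF.integral_eq {p : ℝ≥0∞} (hp : 1 ≤ p) {f : I → ℂ} (hf : MemF p f) :
    ∫ s, f s = f 0 + ∫ s : I, ((1 - (s : ℝ) : ℝ) : ℂ) * deriv01 f s := by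
  have hi : Integrable f := hf.continuous.integrable_of_hasCompactSupport
    (HasCompactSupport.of_compactSpace _)
  have hd : Integrable fun s : I => ((1 - (s : ℝ) : ℝ) : ℂ) * deriv01 f s := by
    refine (hf.integrable_deriv01 hp).bdd_mul (c := 1) ?_ (.of_forall fun s => ?_)
    · exact (by fun_prop : Continuous fun s : I => ((1 - (s : ℝ) : ℝ) : ℂ)).aestronglyMeasurable
    · rw [Complex.norm_real, Real.norm_of_nonneg (sub_nonneg.2 s.2.2)]
      linarith [s.2.1]
  have key : ∀ L : ℂ →L[ℝ] ℝ, L (∫ s, f s) =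
      L (f 0 + ∫ s : I, ((1 - (s : ℝ) : ℝ) : ℂ) * deriv01 f s) := fun L => by
    rw [map_add, ← L.integral_comp_comm hi, ← L.integral_comp_comm hd]
    simp only [← Complex.real_smul, map_smul]
    rw [← sub_eq_iff_eq_add', ← hf.clm_integral_eq L]
    simp only [smul_eq_mul]
  exact Complex.ext (key Complex.reCLM) (key Complex.imCLM)

/-! ### Averages in `L_p` -/

/-- Minkowski's (or Jensen's) inequality: averaging over a probability space is a contraction
of `L_p`. -/
theorem eLpNorm_integral_le {α β E : Type*} [MeasurableSpace α] [MeasurableSpace β]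
    [NormedAddCommGroup E] [NormedSpace ℝ E] {μ : Measure α} {ν : Measure β} [SFinite μ]
    [IsProbabilityMeasure ν] {p : ℝ≥0∞} (hp : 1 ≤ p) {G : α × β → E}
    (hG : AEStronglyMeasurable G (μ.prod ν)) :
    eLpNorm (fun x => ∫ y, G (x, y) ∂ν) p μ ≤ eLpNorm G p (μ.prod ν) := by
  have hle : ∀ᵐ x ∂μ, ‖∫ y, G (x, y) ∂ν‖ₑ ≤ eLpNorm (fun y => G (x, y)) p ν := by
    filter_upwards [hG.prodMk_left] with x hx
    refine (enorm_integral_le_lintegral_enorm _).trans ?_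
    rw [← eLpNorm_one_eq_lintegral_enorm]
    exact eLpNorm_le_eLpNorm_of_exponent_le hp hx
  by_cases hp' : p = ∞
  · subst hp'
    have h : ∀ᵐ z ∂μ.prod ν, ‖G z‖ₑ ≤ eLpNormEssSup G (μ.prod ν) := ae_le_eLpNormEssSup
    rw [eLpNorm_exponent_top, eLpNorm_exponent_top]
    refine eLpNormEssSup_le_of_ae_enorm_bound ?_
    filter_upwards [hle, Measure.ae_ae_of_ae_prod h] with x hx h'
    refine hx.trans ?_
    rw [eLpNorm_exponent_top]
    exact eLpNormEssSup_le_of_ae_enorm_bound h'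
  · have hp0 : p ≠ 0 := (zero_lt_one.trans_le hp).ne'
    have hpr : 0 < p.toReal := ENNReal.toReal_pos hp0 hp'
    rw [eLpNorm_eq_lintegral_rpow_enorm_toReal hp0 hp',
      eLpNorm_eq_lintegral_rpow_enorm_toReal hp0 hp',
      lintegral_prod _ (hG.enorm.pow_const _)]
    gcongr ?_ ^ _
    refine lintegral_mono_ae ?_
    filter_upwards [hle] with x hx
    rw [eLpNorm_eq_lintegral_rpow_enorm_toReal hp0 hp', one_div,
      ENNReal.le_rpow_inv_iff hpr] at hx
    exact hx

/-- Replacing the coordinates in `w` of a random point by those of an independent copy preserves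
the law. -/
theorem measurePreserving_piecewise {ι : Type} [Fintype ι] [DecidableEq ι] (w : Finset ι) :
    MeasurePreserving (fun z : (ι → I) × (ι → I) => w.piecewise z.2 z.1) := by
  have h1 := (volume_measurePreserving_arrowProdEquivProdArrow I I ι).symm
  have h2 : MeasurePreserving (fun (q : ι → I × I) j => if j ∈ w then (q j).2 else (q j).1) := by
    refine measurePreserving_pi (fun _ => volume) (fun _ => volume)
      (f := fun j (q : I × I) => if j ∈ w then q.2 else q.1) fun j => ?_
    by_cases hj : j ∈ w
    · simpa [hj] using! measurePreserving_snd (μ := (volume : Measure I))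
        (ν := (volume : Measure I))
    · simpa [hj] using! measurePreserving_fst (μ := (volume : Measure I))
        (ν := (volume : Measure I))
  exact h2.comp h1

/-! ### Terms of tensor sums -/

/-- The function `x ↦ ∑ k, c k * ∏_{j ∈ u} ψ k j (x j) * ∏_{j ∉ u} a k j`. For
`f = ∑ k, c k * ∏ j, φ k j` and `ψ k j` the derivative of `φ k j`, this is the `u`-th term of the
anchored norm if `a k j = φ k j 0`, and the one of the ANOVA norm if `a k j = ∫ φ k j`. It is a
function on the full cube `[0,1]^d` that depends on `x_u` only, so that the terms for different `u`
live on the same space. -/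
def tensorTerm {ι κ : Type} [Fintype ι] [DecidableEq ι] [Fintype κ] (c : κ → ℂ)
    (ψ : κ → ι → I → ℂ) (a : κ → ι → ℂ) (u : Finset ι) (x : ι → I) : ℂ :=
  ∑ k, c k * ((∏ j ∈ u, ψ k j (x j)) * ∏ j ∈ uᶜ, a k j)

section

variable {ι κ : Type} [Fintype ι] [DecidableEq ι] [Fintype κ] {c : κ → ℂ}
  {ψ : κ → ι → I → ℂ} {a b : κ → ι → ℂ}

theorem aestronglyMeasurable_tensorTerm (hψ : ∀ k j, AEStronglyMeasurable (ψ k j))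
    (u : Finset ι) : AEStronglyMeasurable (tensorTerm c ψ a u) := by
  refine Finset.aestronglyMeasurable_fun_sum _ fun k _ => ?_
  refine AEStronglyMeasurable.const_mul (AEStronglyMeasurable.mul_const ?_ _) _
  refine Finset.aestronglyMeasurable_fun_prod _ fun j _ => ?_
  exact (hψ k j).comp_quasiMeasurePreserving
    (measurePreserving_eval (fun _ : ι => (volume : Measure I)) j).quasiMeasurePreserving

theorem integral_prod_finset (w : Finset ι) (g : ι → I → ℂ) :
    ∫ y : ι → I, ∏ j ∈ w, g j (y j) = ∏ j ∈ w, ∫ s, g j s := by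
  have h := integral_fintype_prod_volume_eq_prod
    (fun (j : ι) (s : I) => if j ∈ w then g j s else 1)
  have h1 : ∀ y : ι → I, ∏ j, (if j ∈ w then g j (y j) else 1) = ∏ j ∈ w, g j (y j) :=
    fun y => by simp
  have h2 : ∏ j, (∫ s, if j ∈ w then g j s else 1) = ∏ j ∈ w, ∫ s, g j s := by
    have h3 : ∀ j, (∫ s, if j ∈ w then g j s else 1) =
        if j ∈ w then ∫ s, g j s else 1 := fun j => by
      split_ifs <;> simp
    simp [h3]
  rw [← h2, ← h]
  simp only [h1]

theorem integrable_prod_finset (w : Finset ι) {g : ι → I → ℂ} (hg : ∀ j, Integrable (g j)) :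
    Integrable fun y : ι → I => ∏ j ∈ w, g j (y j) := by
  have h := Integrable.fintype_prod (μ := fun _ : ι => (volume : Measure I))
    (f := fun (j : ι) (s : I) => if j ∈ w then g j s else 1) fun j => by
      by_cases hj : j ∈ w
      · simpa [hj] using hg j
      · simp [hj]
  refine h.congr (.of_forall fun y => ?_)
  simp

/-- The expansion of `∏_{j ∉ u} (a k j + ∫ θ (ψ k j))` over the subsets `w` of `uᶜ`, with the
integrals for `j ∈ w` collected into one integral of the `(u ∪ w)`-th term for `a`. -/
theorem tensorTerm_eq_sum_integral {θ : I → ℂ} (hψ : ∀ k j, Integrable fun s => θ s * ψ k j s)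
    (hab : ∀ k j, b k j = a k j + ∫ s, θ s * ψ k j s) (u : Finset ι) (x : ι → I) :
    tensorTerm c ψ b u x = ∑ w ∈ uᶜ.powerset,
      ∫ y : ι → I, (∏ j ∈ w, θ (y j)) * tensorTerm c ψ a (u ∪ w) (w.piecewise y x) := by
  have h : ∀ w ∈ uᶜ.powerset,
      (∫ y : ι → I, (∏ j ∈ w, θ (y j)) * tensorTerm c ψ a (u ∪ w) (w.piecewise y x)) =
        ∑ k, c k * ((∏ j ∈ u, ψ k j (x j)) *
          ((∏ j ∈ w, ∫ s, θ s * ψ k j s) * ∏ j ∈ uᶜ \ w, a k j)) := by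
    intro w hw
    have hd : Disjoint u w :=
      Finset.disjoint_right.2 fun j hj => Finset.mem_compl.1 (Finset.mem_powerset.1 hw hj)
    have hc : (u ∪ w)ᶜ = uᶜ \ w := by
      ext j; simp
    have hy : ∀ y : ι → I, (∏ j ∈ w, θ (y j)) * tensorTerm c ψ a (u ∪ w) (w.piecewise y x) =
        ∑ k, (c k * ((∏ j ∈ u, ψ k j (x j)) * ∏ j ∈ uᶜ \ w, a k j)) *
          ∏ j ∈ w, (θ (y j) * ψ k j (y j)) := by
      intro y
      rw [tensorTerm, Finset.mul_sum]
      refine Finset.sum_congr rfl fun k _ => ?_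
      have h1 : ∏ j ∈ u, ψ k j (w.piecewise y x j) = ∏ j ∈ u, ψ k j (x j) :=
        Finset.prod_congr rfl fun j hj => by
          rw [Finset.piecewise_eq_of_notMem _ _ _ (Finset.disjoint_left.1 hd hj)]
      have h2 : ∏ j ∈ w, ψ k j (w.piecewise y x j) = ∏ j ∈ w, ψ k j (y j) :=
        Finset.prod_congr rfl fun j hj => by rw [Finset.piecewise_eq_of_mem _ _ _ hj]
      rw [Finset.prod_union hd, hc, Finset.prod_mul_distrib, h1, h2]
      ring
    simp only [hy]
    rw [integral_finsetSum _ fun k _ => (integrable_prod_finset w (hψ k)).const_mul _]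
    refine Finset.sum_congr rfl fun k _ => ?_
    rw [integral_const_mul, integral_prod_finset w fun j s => θ s * ψ k j s]
    ring
  rw [Finset.sum_congr rfl h, Finset.sum_comm, tensorTerm]
  refine Finset.sum_congr rfl fun k _ => ?_
  rw [← Finset.mul_sum, ← Finset.mul_sum]
  simp only [hab, add_comm (a k _)]
  rw [Finset.prod_add]

/-- If the scalars `b` and `a` differ by `∫ θ ψ` with `|θ| ≤ 1`, the term for `b` and `u` is
controlled by the terms for `a` and the sets `u ∪ w`, `w` disjoint from `u`. -/
theorem eLpNorm_tensorTerm_le {p : ℝ≥0∞} (hp : 1 ≤ p) {θ : I → ℂ} (hθ : Continuous θ)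
    (hθ1 : ∀ s, ‖θ s‖ ≤ 1) (hψ : ∀ k j, Integrable (ψ k j))
    (hab : ∀ k j, b k j = a k j + ∫ s, θ s * ψ k j s) (u : Finset ι) :
    eLpNorm (tensorTerm c ψ b u) p volume ≤
      ∑ w ∈ uᶜ.powerset, eLpNorm (tensorTerm c ψ a (u ∪ w)) p volume := by
  set G : Finset ι → (ι → I) × (ι → I) → ℂ := fun w z =>
    (∏ j ∈ w, θ (z.2 j)) * tensorTerm c ψ a (u ∪ w) (w.piecewise z.2 z.1)
  have hm : ∀ w, AEStronglyMeasurable (tensorTerm c ψ a w) := fun w =>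
    aestronglyMeasurable_tensorTerm (fun k j => (hψ k j).1) w
  have hG : ∀ w, AEStronglyMeasurable (G w) := fun w => by
    refine AEStronglyMeasurable.mul ?_ ((hm (u ∪ w)).comp_measurePreserving
      (measurePreserving_piecewise w))
    exact (by fun_prop : Continuous fun z : (ι → I) × (ι → I) =>
      ∏ j ∈ w, θ (z.2 j)).aestronglyMeasurable
  have hint : ∀ k j, Integrable fun s => θ s * ψ k j s := fun k j =>
    (hψ k j).bdd_mul hθ.aestronglyMeasurable (.of_forall hθ1)
  have heq : tensorTerm c ψ b u =
      ∑ w ∈ uᶜ.powerset, fun x => ∫ y : ι → I, G w (x, y) := by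
    funext x
    rw [tensorTerm_eq_sum_integral hint hab, Finset.sum_apply]
  rw [heq]
  refine (eLpNorm_sum_le (fun w _ => (hG w).integral_prod_right') hp).trans ?_
  refine Finset.sum_le_sum fun w _ => (eLpNorm_integral_le hp (hG w)).trans ?_
  rw [← eLpNorm_comp_measurePreserving (hm (u ∪ w)) (measurePreserving_piecewise w)]
  refine eLpNorm_mono fun z => ?_
  rw [norm_mul, norm_prod]
  exact mul_le_of_le_one_left (norm_nonneg _)
    (Finset.prod_le_one (fun _ _ => norm_nonneg _) fun _ _ => hθ1 _)

end

/-! ### Operators on `ℓ_p` -/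

theorem piLp_norm_mono {ι : Type} [Fintype ι] {p : ℝ≥0∞} [hp : Fact (1 ≤ p)] {E F : ι → Type*}
    [∀ i, SeminormedAddCommGroup (E i)] [∀ i, SeminormedAddCommGroup (F i)]
    {x : PiLp p E} {y : PiLp p F} (h : ∀ i, ‖x i‖ ≤ ‖y i‖) : ‖x‖ ≤ ‖y‖ := by
  by_cases hp' : p = ∞
  · subst hp'
    rw [PiLp.norm_eq_ciSup, PiLp.norm_eq_ciSup]
    exact ciSup_mono (Set.finite_range _).bddAbove h
  · have hpr : 0 < p.toReal := ENNReal.toReal_pos (zero_lt_one.trans_le hp.out).ne' hp'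
    rw [PiLp.norm_eq_sum hpr, PiLp.norm_eq_sum hpr]
    gcongr with i
    exact h i

/-- Translation by union with `w`, restricted to the sets disjoint from `w`, contracts `ℓ_p`. -/
theorem piLp_norm_union_le {ι : Type} [Fintype ι] [DecidableEq ι] {p : ℝ≥0∞}
    [hp : Fact (1 ≤ p)] (A : Finset ι → ℝ) (w : Finset ι) :
    ‖(WithLp.toLp p fun u => if Disjoint u w then A (u ∪ w) else 0 :
      PiLp p fun _ : Finset ι => ℝ)‖ ≤ ‖(WithLp.toLp p A : PiLp p fun _ : Finset ι => ℝ)‖ := by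
  by_cases hp' : p = ∞
  · subst hp'
    rw [PiLp.norm_eq_ciSup, PiLp.norm_eq_ciSup]
    refine ciSup_le fun u => ?_
    have hb := fun v => le_ciSup (f := fun v => ‖A v‖) (Set.finite_range _).bddAbove v
    by_cases h : Disjoint u w
    · simpa [h] using hb (u ∪ w)
    · simpa [h] using (norm_nonneg _).trans (hb u)
  · have hpr : 0 < p.toReal := ENNReal.toReal_pos (zero_lt_one.trans_le hp.out).ne' hp'
    rw [PiLp.norm_eq_sum hpr, PiLp.norm_eq_sum hpr]
    gcongr ?_ ^ _
    have hite : ∀ u : Finset ι, ‖if Disjoint u w then A (u ∪ w) else 0‖ ^ p.toReal =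
        if Disjoint u w then ‖A (u ∪ w)‖ ^ p.toReal else 0 := fun u => by
      split_ifs <;> simp [hpr.ne']
    simp only [hite]
    rw [← Finset.sum_filter]
    -- `u ↦ u ∪ w` is injective on the sets disjoint from `w`
    have hinj : Set.InjOn (fun u : Finset ι => u ∪ w)
        (Finset.univ.filter fun u => Disjoint u w : Finset (Finset ι)) := by
      intro u hu v hv huv
      have hu' := (Finset.mem_filter.1 hu).2
      have hv' := (Finset.mem_filter.1 hv).2
      rw [← Finset.union_sdiff_cancel_right hu', ← Finset.union_sdiff_cancel_right hv']
      exact congrArg (· \ w) huv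
    rw [← Finset.sum_image (f := fun v => ‖A v‖ ^ p.toReal) hinj]
    exact Finset.sum_le_univ_sum_of_nonneg fun v => by positivity

/-- A family dominated by the sum of the `γ_w`-multiples of its translates under union with `w` has
`ℓ_p`-norm at most `∑_w γ_w = ∏_j (1 + γ_j)` times that of the dominating family. -/
theorem piLp_norm_le_prod_mul {ι : Type} [Fintype ι] [DecidableEq ι] {p : ℝ≥0∞}
    [hp : Fact (1 ≤ p)] {E F : Finset ι → Type*} [∀ i, SeminormedAddCommGroup (E i)]
    [∀ i, SeminormedAddCommGroup (F i)] {γ : ι → ℝ} (hγ : ∀ j, 0 ≤ γ j)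
    {x : PiLp p E} {y : PiLp p F}
    (h : ∀ u, ‖x u‖ ≤ ∑ w ∈ uᶜ.powerset, (∏ j ∈ w, γ j) * ‖y (u ∪ w)‖) :
    ‖x‖ ≤ (∏ j, (1 + γ j)) * ‖y‖ := by
  set S : Finset ι → PiLp p fun _ : Finset ι => ℝ := fun w =>
    WithLp.toLp p fun u => if Disjoint u w then ‖y (u ∪ w)‖ else 0
  have hγw : ∀ w : Finset ι, 0 ≤ ∏ j ∈ w, γ j := fun w => Finset.prod_nonneg fun j _ => hγ j
  have h1 : ‖x‖ ≤ ‖∑ w, (∏ j ∈ w, γ j) • S w‖ := by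
    refine piLp_norm_mono fun u => (h u).trans (le_trans (le_of_eq ?_) (le_abs_self _))
    simp only [S, WithLp.ofLp_sum, WithLp.ofLp_smul, Finset.sum_apply, Pi.smul_apply, smul_eq_mul,
      mul_ite, mul_zero]
    rw [← Finset.sum_filter]
    refine Finset.sum_congr ?_ fun _ _ => rfl
    ext w
    simp [Finset.subset_compl_iff_disjoint_left]
  have h2 : ∀ w, ‖S w‖ ≤ ‖y‖ := fun w =>
    (piLp_norm_union_le (fun v => ‖y v‖) w).trans (piLp_norm_mono fun v => by simp)
  refine h1.trans ((norm_sum_le _ _).trans ?_)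
  rw [Finset.prod_one_add, Finset.powerset_univ, Finset.sum_mul]
  refine Finset.sum_le_sum fun w _ => ?_
  rw [norm_smul, Real.norm_of_nonneg (hγw w)]
  exact mul_le_mul_of_nonneg_left (h2 w) (hγw w)

/-! ### The two norms in terms of a representation -/

theorem measurePreserving_subtype_restrict {d : ℕ} (u : Finset (Fin d)) :
    MeasurePreserving fun (x : Fin d → I) (j : {j // j ∈ u}) => x j := by
  have h := measurePreserving_fst.comp (volume_preserving_piEquivPiSubtypeProd (fun _ => I) (· ∈ u))
  convert! h

/-- The passage from `[0,1]^u` to the full cube does not change the `L_p`-norm. -/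
theorem eLpNorm_eq_tensorTerm {d : ℕ} {p : ℝ≥0∞} {κ : Type} [Fintype κ] {c : κ → ℂ}
    {ψ : κ → Fin d → I → ℂ} {a : κ → Fin d → ℂ} {u : Finset (Fin d)}
    {g : ({j // j ∈ u} → I) → ℂ} (hg : AEStronglyMeasurable g)
    (h : g =ᵐ[volume] fun x =>
      ∑ k, c k * ((∏ j : {j // j ∈ u}, ψ k j (x j)) * ∏ j : {j // j ∉ u}, a k j)) :
    eLpNorm g p volume = eLpNorm (tensorTerm c ψ a u) p volume := by
  rw [← eLpNorm_comp_measurePreserving hg (measurePreserving_subtype_restrict u)]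
  refine eLpNorm_congr_ae ?_
  filter_upwards [(measurePreserving_subtype_restrict u).quasiMeasurePreserving.ae h] with x hx
  rw [Function.comp_apply, hx, tensorTerm]
  refine Finset.sum_congr rfl fun k _ => ?_
  rw [Finset.prod_coe_sort u fun j => ψ k j (x j),
    Finset.prod_subtype uᶜ (fun j => Finset.mem_compl) fun j => a k j]

theorem eLpNorm_anchoredTerm {d : ℕ} {p : ℝ≥0∞} [Fact (1 ≤ p)] {f : tensorSpace d p} {κ : Type}
    [Fintype κ] {c : κ → ℂ} {φ : κ → Fin d → I → ℂ} (hf : IsRep p f.1 c φ) (u : Finset (Fin d)) :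
    eLpNorm (anchoredTerm u f.1) p volume =
      eLpNorm (tensorTerm c (fun k j => deriv01 (φ k j)) (fun k j => φ k j 0) u) p volume :=
  eLpNorm_eq_tensorTerm (memLp_anchoredTerm u f).1 (anchoredTerm_ae hf u)

theorem eLpNorm_anovaTerm {d : ℕ} {p : ℝ≥0∞} [Fact (1 ≤ p)] {f : tensorSpace d p} {κ : Type}
    [Fintype κ] {c : κ → ℂ} {φ : κ → Fin d → I → ℂ} (hf : IsRep p f.1 c φ) (u : Finset (Fin d)) :
    eLpNorm (anovaTerm u f.1) p volume =
      eLpNorm (tensorTerm c (fun k j => deriv01 (φ k j)) (fun k j => ∫ s, φ k j s) u) p volume :=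
  eLpNorm_eq_tensorTerm (memLp_anovaTerm u f).1 (anovaTerm_ae hf u)

theorem norm_anchoredMap_apply {d : ℕ} {p : ℝ≥0∞} [Fact (1 ≤ p)] {γ : Finset (Fin d) → ℝ}
    (hγ : ∀ u, 0 < γ u) (f : tensorSpace d p) (u : Finset (Fin d)) :
    ‖anchoredMap d p γ f u‖ = (γ u)⁻¹ * (eLpNorm (anchoredTerm u f.1) p volume).toReal := by
  change ‖((γ u)⁻¹ : ℝ) • (memLp_anchoredTerm u f).toLp _‖ = _
  rw [norm_smul, Lp.norm_toLp, Real.norm_of_nonneg (inv_nonneg.2 (hγ u).le)]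

theorem norm_anovaMap_apply {d : ℕ} {p : ℝ≥0∞} [Fact (1 ≤ p)] {γ : Finset (Fin d) → ℝ}
    (hγ : ∀ u, 0 < γ u) (f : tensorSpace d p) (u : Finset (Fin d)) :
    ‖anovaMap d p γ f u‖ = (γ u)⁻¹ * (eLpNorm (anovaTerm u f.1) p volume).toReal := by
  change ‖((γ u)⁻¹ : ℝ) • (memLp_anovaTerm u f).toLp _‖ = _
  rw [norm_smul, Lp.norm_toLp, Real.norm_of_nonneg (inv_nonneg.2 (hγ u).le)]

theorem norm_toAnchored {d : ℕ} {p : ℝ≥0∞} [Fact (1 ≤ p)] (γ : Finset (Fin d) → ℝ)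
    (f : tensorSpace d p) : ‖toAnchored γ f‖ = ‖anchoredMap d p γ f‖ :=
  UniformSpace.Completion.norm_coe _

theorem norm_toAnova {d : ℕ} {p : ℝ≥0∞} [Fact (1 ≤ p)] (γ : Finset (Fin d) → ℝ)
    (f : tensorSpace d p) : ‖toAnova γ f‖ = ‖anovaMap d p γ f‖ :=
  UniformSpace.Completion.norm_coe _

/-! ### Summable weights: the upper bound -/

/-- The comparison that gives both embeddings: the roles of `a` (values at `0`) and `b` (means) may
be exchanged, with `θ` replaced by `-θ`. -/
theorem norm_le_prod_one_add_mul {d : ℕ} {p : ℝ≥0∞} [hp : Fact (1 ≤ p)] {γ : Fin d → ℝ}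
    (hγ : ∀ j, 0 < γ j) {κ : Type} [Fintype κ] {c : κ → ℂ} {ψ : κ → Fin d → I → ℂ}
    {a b : κ → Fin d → ℂ} {θ : I → ℂ} (hθ : Continuous θ) (hθ1 : ∀ s, ‖θ s‖ ≤ 1) (hψ : ∀ k j, Integrable (ψ k j))
    (hab : ∀ k j, b k j = a k j + ∫ s, θ s * ψ k j s)
    (ha : ∀ u, eLpNorm (tensorTerm c ψ a u) p volume ≠ ∞) {x y : LpSum d p}
    (hx : ∀ u, ‖x u‖ = (∏ j ∈ u, γ j)⁻¹ * (eLpNorm (tensorTerm c ψ b u) p volume).toReal)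
    (hy : ∀ u, ‖y u‖ = (∏ j ∈ u, γ j)⁻¹ * (eLpNorm (tensorTerm c ψ a u) p volume).toReal) :
    ‖x‖ ≤ (∏ j, (1 + γ j)) * ‖y‖ := by
  have hpos : ∀ u : Finset (Fin d), 0 < ∏ j ∈ u, γ j := fun u => Finset.prod_pos fun j _ => hγ j
  refine piLp_norm_le_prod_mul (fun j => (hγ j).le) fun u => ?_
  have h := ENNReal.toReal_mono (ENNReal.sum_ne_top.2 fun w _ => ha (u ∪ w))
    (eLpNorm_tensorTerm_le (c := c) hp.out hθ hθ1 hψ hab u)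
  rw [ENNReal.toReal_sum fun w _ => ha (u ∪ w)] at h
  rw [hx]
  refine (mul_le_mul_of_nonneg_left h (inv_nonneg.2 (hpos u).le)).trans (le_of_eq ?_)
  rw [Finset.mul_sum]
  refine Finset.sum_congr rfl fun w hw => ?_
  have hd : Disjoint u w :=
    Finset.disjoint_right.2 fun j hj => Finset.mem_compl.1 (Finset.mem_powerset.1 hw hj)
  rw [hy, Finset.prod_union hd]
  field_simp [(hpos u).ne', (hpos w).ne']

theorem continuous_one_sub : Continuous fun s : I => ((1 - (s : ℝ) : ℝ) : ℂ) := by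
  fun_prop

theorem norm_one_sub_le (s : I) : ‖((1 - (s : ℝ) : ℝ) : ℂ)‖ ≤ 1 := by
  rw [Complex.norm_real, Real.norm_of_nonneg (sub_nonneg.2 s.2.2)]
  linarith [s.2.1]

theorem norm_anovaMap_le {d : ℕ} {p : ℝ≥0∞} [hp : Fact (1 ≤ p)] {γ : Fin d → ℝ}
    (hγ : ∀ j, 0 < γ j) (f : tensorSpace d p) :
    ‖anovaMap d p (fun u => ∏ j ∈ u, γ j) f‖ ≤
      (∏ j, (1 + γ j)) * ‖anchoredMap d p (fun u => ∏ j ∈ u, γ j) f‖ := by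
  obtain ⟨κ, _, c, φ, h⟩ := exists_isRep f.2
  have hpos : ∀ u : Finset (Fin d), 0 < ∏ j ∈ u, γ j := fun u => Finset.prod_pos fun j _ => hγ j
  refine norm_le_prod_one_add_mul (c := c) hγ continuous_one_sub norm_one_sub_le
    (fun k j => (h.1 k j).integrable_deriv01 hp.out) (fun k j => (h.1 k j).integral_eq hp.out)
    (fun u => ?_) (fun u => ?_) fun u => ?_
  · rw [← eLpNorm_anchoredTerm h]
    exact (memLp_anchoredTerm u f).2.ne
  · rw [norm_anovaMap_apply hpos, eLpNorm_anovaTerm h]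
  · rw [norm_anchoredMap_apply hpos, eLpNorm_anchoredTerm h]

theorem norm_anchoredMap_le {d : ℕ} {p : ℝ≥0∞} [hp : Fact (1 ≤ p)] {γ : Fin d → ℝ}
    (hγ : ∀ j, 0 < γ j) (f : tensorSpace d p) :
    ‖anchoredMap d p (fun u => ∏ j ∈ u, γ j) f‖ ≤
      (∏ j, (1 + γ j)) * ‖anovaMap d p (fun u => ∏ j ∈ u, γ j) f‖ := by
  obtain ⟨κ, _, c, φ, h⟩ := exists_isRep f.2
  have hpos : ∀ u : Finset (Fin d), 0 < ∏ j ∈ u, γ j := fun u => Finset.prod_pos fun j _ => hγ j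
  refine norm_le_prod_one_add_mul (c := c) (a := fun k j => ∫ s, φ k j s)
    (b := fun k j => φ k j 0) hγ
    continuous_one_sub.neg (fun s => (norm_neg _).trans_le (norm_one_sub_le s))
    (fun k j => (h.1 k j).integrable_deriv01 hp.out) (fun k j => ?_)
    (fun u => ?_) (fun u => ?_) fun u => ?_
  · simp only [Pi.neg_apply, neg_mul, integral_neg]
    rw [(h.1 k j).integral_eq hp.out, add_neg_cancel_right]
  · rw [← eLpNorm_anovaTerm h]
    exact (memLp_anovaTerm u f).2.ne
  · rw [norm_anchoredMap_apply hpos, eLpNorm_anchoredTerm h]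
  · rw [norm_anovaMap_apply hpos, eLpNorm_anovaTerm h]

/-! ### Divergent weights: the test functions -/

/-- The test function `s ↦ 1 + g s` on `[0,1]`. -/
def affine01 (g : ℝ) (s : I) : ℂ := ((1 + g * s : ℝ) : ℂ)

theorem deriv01_affine01 (g : ℝ) : deriv01 (affine01 g) = fun _ => (g : ℂ) := by
  funext x
  have h : HasDerivWithinAt (fun y : ℝ => ((1 + g * y : ℝ) : ℂ)) g (Set.Icc (0 : ℝ) 1) x := by
    have := (((hasDerivAt_id (x : ℝ)).const_mul g).const_add 1).ofReal_comp
    simpa using! this.hasDerivWithinAt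
  refine (h.congr (fun y hy => ?_) ?_).derivWithin (uniqueDiffOn_Icc_zero_one _ x.2)
  · exact Set.IccExtend_of_mem _ _ hy
  · exact Set.IccExtend_val _ _ _

theorem memF_affine01 (p : ℝ≥0∞) (g : ℝ) : MemF p (affine01 g) := by
  refine ⟨?_, ?_⟩
  · have h : LipschitzWith ‖g‖₊ (affine01 g) := LipschitzWith.of_dist_le_mul fun x y => by
      rw [affine01, affine01, Complex.dist_of_im_eq (by simp), Complex.ofReal_re,
        Complex.ofReal_re, Real.dist_eq, Subtype.dist_eq, Real.dist_eq, coe_nnnorm,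
        Real.norm_eq_abs, ← abs_mul]
      apply le_of_eq
      congr 1
      ring
    exact (h.comp (LipschitzWith.projIcc zero_le_one)).lipschitzOnWith.absolutelyContinuousOnInterval
  · rw [deriv01_affine01]
    exact memLp_const _

theorem integral_affine01 (g : ℝ) : ∫ s, affine01 g s = ((1 + g / 2 : ℝ) : ℂ) := by
  have hi : IntervalIntegrable (fun x : ℝ => g * x) volume 0 1 :=
    (by fun_prop : Continuous fun x : ℝ => g * x).intervalIntegrable _ _
  simp only [affine01]
  rw [integral_complex_ofReal, integral_unitInterval_eq fun x => 1 + g * x,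
    intervalIntegral.integral_add (by simp) hi,
    intervalIntegral.integral_const_mul, integral_id, intervalIntegral.integral_const]
  norm_num
  ring

/-- The tensor product of the functions `1 + γ_j x_j`. -/
def affineProd {d : ℕ} (p : ℝ≥0∞) (γ : Fin d → ℝ) : tensorSpace d p :=
  ⟨fun x => ∏ j, affine01 (γ j) (x j), Submodule.subset_span
    ⟨fun j => affine01 (γ j), fun j => memF_affine01 p (γ j), rfl⟩⟩

theorem isRep_affineProd {d : ℕ} (p : ℝ≥0∞) (γ : Fin d → ℝ) :
    IsRep p (affineProd p γ).1 (fun _ : Unit => 1) (fun _ j => affine01 (γ j)) :=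
  ⟨fun _ j => memF_affine01 p (γ j), by funext x; simp [affineProd]⟩

theorem eLpNorm_tensorTerm_const {d : ℕ} {p : ℝ≥0∞} (hp : 1 ≤ p) {γ a : Fin d → ℝ}
    (hγ : ∀ j, 0 < γ j) (ha : ∀ j, 0 ≤ a j) (u : Finset (Fin d)) :
    (eLpNorm (tensorTerm (fun _ : Unit => 1) (fun _ j => deriv01 (affine01 (γ j)))
      (fun _ j => (a j : ℂ)) u) p volume).toReal = (∏ j ∈ u, γ j) * ∏ j ∈ uᶜ, a j := by
  have h : tensorTerm (fun _ : Unit => 1) (fun _ j => deriv01 (affine01 (γ j)))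
      (fun _ j => (a j : ℂ)) u = fun _ => (((∏ j ∈ u, γ j) * ∏ j ∈ uᶜ, a j : ℝ) : ℂ) := by
    funext x
    simp [tensorTerm, deriv01_affine01]
  have h0 : 0 ≤ (∏ j ∈ u, γ j) * ∏ j ∈ uᶜ, a j := mul_nonneg
    (Finset.prod_nonneg fun j _ => (hγ j).le) (Finset.prod_nonneg fun j _ => ha j)
  rw [h, eLpNorm_const _ (zero_lt_one.trans_le hp).ne' (NeZero.ne _)]
  rw [measure_univ, ENNReal.one_rpow, mul_one, toReal_enorm, Complex.norm_real,
    Real.norm_of_nonneg h0]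

theorem norm_anchoredMap_affineProd {d : ℕ} {p : ℝ≥0∞} [hp : Fact (1 ≤ p)] {γ : Fin d → ℝ}
    (hγ : ∀ j, 0 < γ j) (u : Finset (Fin d)) :
    ‖anchoredMap d p (fun u => ∏ j ∈ u, γ j) (affineProd p γ) u‖ = 1 := by
  have hpos : ∀ u : Finset (Fin d), 0 < ∏ j ∈ u, γ j := fun u => Finset.prod_pos fun j _ => hγ j
  have h0 : ∀ j, affine01 (γ j) 0 = ((1 : ℝ) : ℂ) := fun j => by simp [affine01]
  rw [norm_anchoredMap_apply hpos, eLpNorm_anchoredTerm (isRep_affineProd p γ)]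
  simp only [h0]
  rw [eLpNorm_tensorTerm_const (a := fun _ => 1) hp.out hγ (fun _ => zero_le_one),
    Finset.prod_const_one, mul_one, inv_mul_cancel₀ (hpos u).ne']

theorem norm_anovaMap_affineProd {d : ℕ} {p : ℝ≥0∞} [hp : Fact (1 ≤ p)] {γ : Fin d → ℝ}
    (hγ : ∀ j, 0 < γ j) (u : Finset (Fin d)) :
    ‖anovaMap d p (fun u => ∏ j ∈ u, γ j) (affineProd p γ) u‖ = ∏ j ∈ uᶜ, (1 + γ j / 2) := by
  have hpos : ∀ u : Finset (Fin d), 0 < ∏ j ∈ u, γ j := fun u => Finset.prod_pos fun j _ => hγ j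
  rw [norm_anovaMap_apply hpos, eLpNorm_anovaTerm (isRep_affineProd p γ)]
  simp only [integral_affine01]
  rw [eLpNorm_tensorTerm_const (a := fun j => 1 + γ j / 2) hp.out hγ fun j => by
    have := hγ j; positivity]
  rw [inv_mul_cancel_left₀ (hpos u).ne']

theorem one_add_sum_range_le_prod {g : ℕ → ℝ} (hg : ∀ j, 0 ≤ g j) (n : ℕ) :
    1 + ∑ j ∈ Finset.range n, g j ≤ ∏ j ∈ Finset.range n, (1 + g j) := by
  induction n with
  | zero => simp
  | succ n ih =>
    have h0 : 0 ≤ ∑ j ∈ Finset.range n, g j := Finset.sum_nonneg fun j _ => hg j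
    rw [Finset.sum_range_succ, Finset.prod_range_succ]
    nlinarith [mul_le_mul_of_nonneg_right ih (hg n), mul_nonneg h0 (hg n)]

/-- The power mean inequality: the ratio of the `ℓ_p`-norm of `x` to that of a family of unit vectors
is at least the arithmetic mean of the `‖x i‖`, for `p = ∞` as well. -/
theorem piLp_sum_norm_le_of_norm_eq_one {ι : Type} [Fintype ι] [Nonempty ι] {p : ℝ≥0∞}
    [hp : Fact (1 ≤ p)] {E F : ι → Type*} [∀ i, SeminormedAddCommGroup (E i)]
    [∀ i, SeminormedAddCommGroup (F i)] {x : PiLp p E} {y : PiLp p F} {c : ℝ}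
    (hy : ∀ i, ‖y i‖ = 1) (h : ‖x‖ ≤ c * ‖y‖) : ∑ i, ‖x i‖ ≤ c * Fintype.card ι := by
  have hcard : (0 : ℝ) < Fintype.card ι := by exact_mod_cast Fintype.card_pos
  by_cases hp' : p = ∞
  · subst hp'
    have hy1 : ‖y‖ = 1 := by
      rw [PiLp.norm_eq_ciSup]; simp [hy]
    rw [hy1, mul_one] at h
    refine (Finset.sum_le_card_nsmul _ _ c fun i _ => (PiLp.norm_apply_le x i).trans h).trans_eq ?_
    simp [mul_comm]
  · have hpr : 1 ≤ p.toReal := by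
      simpa using ENNReal.toReal_mono hp' hp.out
    have hpr0 : 0 < p.toReal := zero_lt_one.trans_le hpr
    rw [PiLp.norm_eq_sum hpr0, PiLp.norm_eq_sum hpr0] at h
    simp only [hy, Real.one_rpow, Finset.sum_const, Finset.card_univ, nsmul_eq_mul, mul_one] at h
    have key := Real.arith_mean_le_rpow_mean Finset.univ (fun _ : ι => (Fintype.card ι : ℝ)⁻¹)
      (fun i => ‖x i‖) (fun _ _ => by positivity) (by simp) (fun _ _ => norm_nonneg _) hpr
    rw [← Finset.mul_sum, ← Finset.mul_sum, Real.mul_rpow (by positivity)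
      (Finset.sum_nonneg fun _ _ => by positivity), Real.inv_rpow hcard.le] at key
    have hr : (0 : ℝ) < (Fintype.card ι : ℝ) ^ (1 / p.toReal) := Real.rpow_pos_of_pos hcard _
    rw [← div_le_iff₀ hcard, div_eq_inv_mul]
    refine key.trans ?_
    rw [inv_mul_le_iff₀ hr, mul_comm]
    exact h

/-- The lower bound for the norm of the embedding into the ANOVA space, from the test function
`affineProd`. -/
theorem prod_one_add_le_of_norm_anovaMap_le {d : ℕ} {p : ℝ≥0∞} [hp : Fact (1 ≤ p)]
    {γ : Fin d → ℝ} (hγ : ∀ j, 0 < γ j) {c : ℝ}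
    (h : ∀ f, ‖anovaMap d p (fun u => ∏ j ∈ u, γ j) f‖ ≤
      c * ‖anchoredMap d p (fun u => ∏ j ∈ u, γ j) f‖) :
    ∏ j, (1 + γ j / 4) ≤ c := by
  have h1 := piLp_sum_norm_le_of_norm_eq_one (norm_anchoredMap_affineProd hγ)
    (h (affineProd p γ))
  simp only [norm_anovaMap_affineProd hγ] at h1
  have h2 : ∑ u : Finset (Fin d), ∏ j ∈ uᶜ, (1 + γ j / 2) = (∏ j, (1 + γ j / 4)) * 2 ^ d := by
    have h3 := Fintype.prod_add (fun _ : Fin d => (1 : ℝ)) fun j => 1 + γ j / 2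
    simp only [Finset.prod_const_one, one_mul] at h3
    have h4 : ∏ _j : Fin d, (2 : ℝ) = 2 ^ d := by simp
    rw [← h3, ← h4, ← Finset.prod_mul_distrib]
    exact Finset.prod_congr rfl fun j _ => by ring
  rw [h2, Fintype.card_finset, Fintype.card_fin] at h1
  push_cast at h1
  exact le_of_mul_le_mul_right h1 (by positivity)

/-! ### Extension to the completions -/

/-- A linear map bounded by `C` in the seminorms extends to the completions with norm at
most `C`. -/
theorem exists_completion_extension {E F : Type} [SeminormedAddCommGroup E] [NormedSpace ℂ E]
    [SeminormedAddCommGroup F] [NormedSpace ℂ F] (f : E →ₗ[ℂ] F) {C : ℝ} (hC : 0 ≤ C)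
    (h : ∀ x, ‖f x‖ ≤ C * ‖x‖) :
    ∃ J : UniformSpace.Completion E →L[ℂ] UniformSpace.Completion F,
      (∀ x : E, J (x : UniformSpace.Completion E) = (f x : UniformSpace.Completion F)) ∧
        ‖J‖ ≤ C := by
  set e : E →ₗ[ℂ] UniformSpace.Completion E :=
    (UniformSpace.Completion.toComplL : E →L[ℂ] UniformSpace.Completion E).toLinearMap
  set g : E →ₗ[ℂ] UniformSpace.Completion F :=
    (UniformSpace.Completion.toComplL : F →L[ℂ] UniformSpace.Completion F).toLinearMap ∘ₗ f
  have hd : DenseRange e := UniformSpace.Completion.denseRange_coe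
  have hb : ∀ x, ‖g x‖ ≤ C * ‖e x‖ := fun x => by
    simpa [e, g] using h x
  exact ⟨g.extendOfNorm e, fun x => LinearMap.extendOfNorm_eq hd ⟨C, hb⟩ x,
    LinearMap.opNorm_extendOfNorm_le hd hC hb⟩

/-- Uniform equivalence is a pair of dimension-free norm inequalities on `F_{d,p}` itself, which is
dense in both completions. -/
theorem uniformlyEquivalent_iff {p : ℝ≥0∞} [Fact (1 ≤ p)] {γ : (d : ℕ) → Finset (Fin d) → ℝ} :
    UniformlyEquivalent p γ ↔ ∃ c : ℝ, 0 < c ∧ ∀ (d : ℕ) (f : tensorSpace d p),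
      ‖anovaMap d p (γ d) f‖ ≤ c * ‖anchoredMap d p (γ d) f‖ ∧
        ‖anchoredMap d p (γ d) f‖ ≤ c * ‖anovaMap d p (γ d) f‖ := by
  refine exists_congr fun c => and_congr_right fun hc => forall_congr' fun d => ⟨?_, fun h => ?_⟩
  · rintro ⟨J, J', hJ, hJ', hn⟩ f
    rw [← norm_toAnova, ← norm_toAnchored]
    refine ⟨?_, ?_⟩
    · rw [← hJ f]
      exact J.le_of_opNorm_le ((le_max_left _ _).trans hn) _
    · rw [← hJ' f]
      exact J'.le_of_opNorm_le ((le_max_right _ _).trans hn) _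
  · obtain ⟨J, hJ, hJn⟩ := exists_completion_extension
      (E := PreAnchored d p (γ d)) (F := PreAnova d p (γ d))
      (LinearMap.id (R := ℂ) (M := tensorSpace d p)) hc.le fun f => (h f).1
    obtain ⟨J', hJ', hJn'⟩ := exists_completion_extension
      (E := PreAnova d p (γ d)) (F := PreAnchored d p (γ d))
      (LinearMap.id (R := ℂ) (M := tensorSpace d p)) hc.le fun f => (h f).2
    exact ⟨J, J', hJ, hJ', max_le hJn hJn'⟩

end AnchoredAnova

end

theorem corollary3 (p : ENNReal) [Fact (1 ≤ p)] (γ : ℕ → ℝ) (hγ : ∀ j, 0 < γ j) :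
    AnchoredAnova.UniformlyEquivalent p (fun d (u : Finset (Fin d)) => ∏ j ∈ u, γ j) ↔
      Summable γ := by
  rw [AnchoredAnova.uniformlyEquivalent_iff]
  constructor
  · rintro ⟨c, -, h⟩
    have hd : ∀ d, ∑ j ∈ Finset.range d, γ j / 4 ≤ c := fun d => by
      have h1 : ∏ j : Fin d, (1 + γ j / 4) ≤ c :=
        AnchoredAnova.prod_one_add_le_of_norm_anovaMap_le (p := p) (fun j => hγ j)
          fun f => (h d f).1
      rw [Fin.prod_univ_eq_prod_range (fun j => 1 + γ j / 4)] at h1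
      have h2 := AnchoredAnova.one_add_sum_range_le_prod
        (fun j => (div_pos (hγ j) four_pos).le) d
      linarith
    refine (summable_div_const_iff (four_ne_zero : (4 : ℝ) ≠ 0)).1 ?_
    exact summable_of_sum_range_le (fun j => (div_pos (hγ j) four_pos).le) hd
  · intro hs
    have hc : ∀ d, ∏ j : Fin d, (1 + γ j) ≤ Real.exp (∑' j, γ j) := fun d => by
      refine (Real.prod_one_add_le_exp_sum _ fun j : Fin d => (hγ j).le).trans ?_
      rw [Real.exp_le_exp, Fin.sum_univ_eq_sum_range γ]
      exact hs.sum_le_tsum _ fun j _ => (hγ j).le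
    refine ⟨Real.exp (∑' j, γ j), Real.exp_pos _, fun d f => ⟨?_, ?_⟩⟩
    · exact (AnchoredAnova.norm_anovaMap_le (fun j => hγ j) f).trans
        (mul_le_mul_of_nonneg_right (hc d) (norm_nonneg _))
    · exact (AnchoredAnova.norm_anchoredMap_le (fun j => hγ j) f).trans
        (mul_le_mul_of_nonneg_right (hc d) (norm_nonneg _))
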